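/- In the $p$-player dart game ($p\ge 1$), players $1,\dots,p$ stand in a line and the player in front throws a dart. If the dart lands strictly closer to the center than all previously thrown darts (in particular, if it is the first dart), the player moves to the back of the line; otherwise the player is eliminated. The game ends as soon as only one player remains. The distances $X_0,X_1,X_2,\dots$ of the successive darts to the center are i.i.d. real random variables such that $\Pr(X_i=X_j)=0$ for $i\neq j$. Let $L_p$ be the number of throws in the game ($L_p=\infty$ if the game never ends) and let $E_p=\mathbb{E}(L_p)\in[0,\infty]$. Then $E_p<\infty$ for all $p\ge1$, and for every complex $u$ with $|u|<1$ $$\sum_{p\ge 1}E_p u^p = u^2(1-u)^{-1-1/u},$$ where the power is the principal branch and the right-hand side is read as $0$ at $u=0$. Moreover, as $p\to\infty$, $$E_p = p+\log p+\gamma-1+o(1),$$ where $\gamma$ is the Euler–Mascheroni constant. -/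

import Mathlib

open MeasureTheory ProbabilityTheory Filter Topology
open scoped ENNReal

namespace DartGame

/-- Throw number `n` (throws are numbered from `0`) lands strictly closer to the center than all
previously thrown darts; `x i` is the distance of throw `i` to the center. -/
def IsBest (x : ℕ → ℝ) (n : ℕ) : Prop := ∀ m < n, x n < x m

open Classical in
/-- The effect of one throw on the line of remaining players. As long as at least two players
remain, the player in front throws: he goes to the back of the line if he `stays`, and otherwise
he is eliminated. Once at most one player remains nothing changes any more. -/
noncomputable def step {α : Type*} (stays : Prop) : List α → List α
  | k :: k' :: rest => if stays then (k' :: rest) ++ [k] else k' :: rest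
  | l => l

/-- The line of remaining players, front first, after `n` throws of the `p`-player game with
distances `x`. -/
noncomputable def line (p : ℕ) (x : ℕ → ℝ) : ℕ → List (Fin p)
  | 0 => List.finRange p
  | n + 1 => step (IsBest x n) (line p x n)

/-- The length of the `p`-player game with distances `x`: the least number of throws after which
exactly one player remains, and `∞` if this never happens. -/
noncomputable def gameLength (p : ℕ) (x : ℕ → ℝ) : ℕ∞ :=
  ⨅ (n : ℕ) (_ : (line p x n).length = 1), (n : ℕ∞)

/-- The expected number of throws in the `p`-player game, as an element of `[0, ∞]`. -/
noncomputable def expectedLength {Ω : Type*} [MeasurableSpace Ω] (P : Measure Ω) (X : ℕ → Ω → ℝ)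
    (p : ℕ) : ℝ≥0∞ :=
  ∫⁻ ω, (gameLength p (fun i => X i ω) : ℝ≥0∞) ∂P

end DartGame

namespace DartGame

/-! The game lasts more than `k` throws exactly when the first `k` throws contain at most `p - 2`
misses (non-records), so `E_p` is the sum of `sojourn m` over `m < p - 1`. By exchangeability throw
`n` is a record with probability `1/(n+1)`, independently of the number of earlier misses; hence the
miss count is a Markov chain with law `missProb`.

Its generating function after `n` throws is `∏ (1 + j u)/(j + 1)`. Summing over `n` gives the
binomial series of `(1 - u)^(-1/u)`, and passing to partial sums costs a factor `1/(1 - u)`.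

For the asymptotics, each level `m` is left exactly once, so `∑ₙ missProb n m * n/(n+1) = 1`. Thus
`sojourn m - 1` is the expected number of records at level `m`; over the levels below `N` these
total the harmonic number `H_N` plus a tail that is at most `H_N / N`. -/

/-! ### Law of the miss count and its generating functions -/

/-- The probability that exactly `m` of the first `n` throws are not records. -/
noncomputable def missProb : ℕ → ℕ → ℝ
  | 0, 0 => 1
  | 0, _ + 1 => 0
  | n + 1, 0 => missProb n 0 / (n + 1)
  | n + 1, m + 1 => missProb n (m + 1) / (n + 1) + n / (n + 1) * missProb n m

theorem missProb_nonneg (n m : ℕ) : 0 ≤ missProb n m := by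
  induction n generalizing m with
  | zero => cases m <;> simp [missProb]
  | succ n ih =>
    have h := ih m
    cases m with
    | zero => simp only [missProb]; positivity
    | succ m =>
      have h' := ih m
      simp only [missProb]; positivity

theorem missProb_eq_zero_of_lt {n m : ℕ} (h : n < m) : missProb n m = 0 := by
  induction n generalizing m with
  | zero => cases m with
    | zero => omega
    | succ m => simp [missProb]
  | succ n ih => cases m with
    | zero => omega
    | succ m => simp [missProb, ih (show n < m + 1 by omega), ih (show n < m by omega)]

/-- Throw `j` contributes the independent factor `1/(j+1) + u * j/(j+1)`. -/
theorem hasSum_missProb_mul_pow (n : ℕ) (u : ℂ) :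
    HasSum (fun m => (missProb n m : ℂ) * u ^ m)
      (∏ j ∈ Finset.range n, (1 + j * u) / (j + 1)) := by
  induction n with
  | zero =>
    have h : (fun m => (missProb 0 m : ℂ) * u ^ m) = fun m => if m = 0 then 1 else 0 := by
      funext m
      cases m <;> simp [missProb]
    rw [h, Finset.prod_range_zero]
    exact hasSum_ite_eq 0 1
  | succ n ih =>
    have h1 := ih.mul_right (1 / ((n : ℂ) + 1))
    have h2 : HasSum (fun m : ℕ => if m = 0 then 0 else
        (n : ℂ) / (n + 1) * missProb n (m - 1) * u ^ m)
        ((∏ j ∈ Finset.range n, (1 + j * u) / (j + 1)) * (n * u / (n + 1))) := by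
      rw [← hasSum_nat_add_iff' 1]
      simp only [Finset.range_one, Finset.sum_singleton, if_true, sub_zero]
      convert! ih.mul_right (n * u / (n + 1)) using 1
      funext m
      simp only [Nat.succ_ne_zero, if_false, Nat.add_sub_cancel]
      ring
    rw [Finset.prod_range_succ]
    convert! h1.add h2 using 1
    · funext m
      cases m with
      | zero => simp [missProb, div_eq_mul_inv]
      | succ m => simp [missProb]; ring
    · ring

/-- The expected number of moments at which exactly `m` players have been eliminated, in a game
which goes on forever. -/
noncomputable def sojourn (m : ℕ) : ℝ := ∑' n, missProb n m

theorem summable_prod_ratio {r : ℝ} (h0 : 0 < r) (h1 : r < 1) :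
    Summable fun n : ℕ => ∏ j ∈ Finset.range n, (1 + j * r) / (j + 1) := by
  have hpos : ∀ n : ℕ, 0 < ∏ j ∈ Finset.range n, (1 + j * r) / (j + 1) := fun n =>
    Finset.prod_pos fun j _ => by positivity
  refine summable_of_ratio_test_tendsto_lt_one h1 (Eventually.of_forall fun n => (hpos n).ne') ?_
  have h : (fun n : ℕ => ‖∏ j ∈ Finset.range (n + 1), (1 + j * r) / (j + 1)‖ /
      ‖∏ j ∈ Finset.range n, (1 + j * r) / (j + 1)‖) =
      fun n : ℕ => r + (1 - r) * (1 / ((n : ℝ) + 1)) := by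
    funext n
    rw [Real.norm_of_nonneg (hpos _).le, Real.norm_of_nonneg (hpos _).le, Finset.prod_range_succ,
      mul_div_cancel_left₀ _ (hpos n).ne']
    field_simp
    ring
  rw [h]
  simpa using (tendsto_one_div_add_atTop_nhds_zero_nat (𝕜 := ℝ)).const_mul (1 - r) |>.const_add r

theorem hasSum_missProb_mul_pow_real (n : ℕ) (u : ℝ) :
    HasSum (fun m => missProb n m * u ^ m) (∏ j ∈ Finset.range n, (1 + j * u) / (j + 1)) := by
  have := hasSum_missProb_mul_pow n u
  rw [← Complex.hasSum_ofReal]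
  simpa using this

theorem summable_missProb_mul_pow {r : ℝ} (h0 : 0 < r) (h1 : r < 1) :
    Summable fun x : ℕ × ℕ => missProb x.1 x.2 * r ^ x.2 := by
  rw [summable_prod_of_nonneg fun x => mul_nonneg (missProb_nonneg _ _) (by positivity)]
  refine ⟨fun n => (hasSum_missProb_mul_pow_real n r).summable, ?_⟩
  simp_rw [(hasSum_missProb_mul_pow_real _ r).tsum_eq]
  exact summable_prod_ratio h0 h1

theorem summable_missProb (m : ℕ) : Summable fun n => missProb n m := by
  have h := (summable_missProb_mul_pow (r := 1 / 2) (by norm_num) (by norm_num)).prod_symm.prod_factor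
    m
  simpa using h.mul_right ((1 / 2 : ℝ) ^ m)⁻¹

theorem sojourn_nonneg (m : ℕ) : 0 ≤ sojourn m := tsum_nonneg fun _ => missProb_nonneg _ _

/-- Pulling `u` out of each factor turns the `n`-th term into `u^n * ∏ (1/u + j) / n!`, the `n`-th
term of the series of `(1 - z)^(-1/u)` at `z = u`. -/
theorem hasSum_binomial {u : ℂ} (hu : u ≠ 0) (hu1 : ‖u‖ < 1) :
    HasSum (fun n : ℕ => ∏ j ∈ Finset.range n, (1 + j * u) / (j + 1)) ((1 - u) ^ (-1 / u)) := by
  have h := (Complex.one_div_one_sub_cpow_hasFPowerSeriesOnBall_zero (1 / u)).hasSum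
    (y := u) (by simpa [enorm_eq_nnnorm, ← NNReal.coe_lt_coe] using hu1)
  simp only [zero_add, one_div, ← Complex.cpow_neg] at h
  rw [neg_div, one_div]
  convert! h using 1
  funext n
  rw [FormalMultilinearSeries.ofScalars_apply_eq, ← Ring.multichoose_eq, smul_eq_mul]
  have hf : (n.factorial : ℂ) ≠ 0 := by exact_mod_cast n.factorial_ne_zero
  have h1 : (n.factorial : ℂ) * Ring.multichoose u⁻¹ n = ∏ j ∈ Finset.range n, (u⁻¹ + j) := by
    rw [← nsmul_eq_mul, Ring.factorial_nsmul_multichoose_eq_ascPochhammer]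
    induction n with
    | zero => simp
    | succ n ih =>
      rw [Finset.prod_range_succ, ← ih (by exact_mod_cast n.factorial_ne_zero)]
      simp [ascPochhammer_succ_right, Polynomial.smeval_mul, Polynomial.smeval_add,
        Polynomial.smeval_natCast]
  rw [← mul_right_inj' hf, ← mul_assoc, h1, Finset.prod_div_distrib]
  have h2 : ∏ j ∈ Finset.range n, ((j : ℂ) + 1) = n.factorial := by
    exact_mod_cast Finset.prod_range_add_one_eq_factorial n
  rw [h2, mul_div_cancel₀ _ hf]
  have h3 : u ^ n = ∏ _j ∈ Finset.range n, u := by simp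
  rw [h3, ← Finset.prod_mul_distrib]
  refine Finset.prod_congr rfl fun j _ => ?_
  field_simp

/-- Fubini for the double series over `(n, m)`, which converges absolutely by the ratio test at
`‖u‖`. -/
theorem hasSum_sojourn_mul_pow {u : ℂ} (hu : u ≠ 0) (hu1 : ‖u‖ < 1) :
    HasSum (fun m => (sojourn m : ℂ) * u ^ m) ((1 - u) ^ (-1 / u)) ∧
    Summable (fun m => ‖(sojourn m : ℂ) * u ^ m‖) := by
  have hn : (fun x : ℕ × ℕ => ‖(missProb x.1 x.2 : ℂ) * u ^ x.2‖) =
      fun x => missProb x.1 x.2 * ‖u‖ ^ x.2 := by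
    funext x
    simp [abs_of_nonneg (missProb_nonneg x.1 x.2)]
  have hr := summable_missProb_mul_pow (norm_pos_iff.2 hu) hu1
  have hs : Summable fun x : ℕ × ℕ => (missProb x.1 x.2 : ℂ) * u ^ x.2 := by
    apply Summable.of_norm
    rwa [hn]
  have hm (m : ℕ) : HasSum (fun n => (missProb n m : ℂ) * u ^ m) ((sojourn m : ℂ) * u ^ m) :=
    (Complex.hasSum_ofReal.2 (summable_missProb m).hasSum).mul_right _
  constructor
  · have h1 := hs.hasSum.prod_fiberwise fun n => hasSum_missProb_mul_pow n u
    rw [(hasSum_binomial hu hu1).unique h1]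
    exact ((Equiv.prodComm ℕ ℕ).hasSum_iff.2 hs.hasSum).prod_fiberwise hm
  · have h2 := hr.prod_symm.prod
    convert! h2 using 2
    rename_i m
    rw [norm_mul, Complex.norm_of_nonneg (sojourn_nonneg m), norm_pow, sojourn, ← tsum_mul_right]
    rfl

theorem hasSum_sum_sojourn_mul_pow {u : ℂ} (hu1 : ‖u‖ < 1) :
    HasSum (fun p : ℕ => ((∑ m ∈ Finset.range p, sojourn m : ℝ) : ℂ) * u ^ (p + 1))
      (u ^ 2 * (1 - u) ^ (-1 - 1 / u)) := by
  rcases eq_or_ne u 0 with rfl | hu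
  · simp
  obtain ⟨h1, h2⟩ := hasSum_sojourn_mul_pow hu hu1
  have h1u : 1 - u ≠ 0 := by
    rw [sub_ne_zero]
    rintro rfl
    simp at hu1
  have h3 := hasSum_sum_range_mul_of_summable_norm h2 (g := fun n => u ^ n)
    (by simpa using summable_geometric_of_lt_one (norm_nonneg u) hu1)
  rw [h1.tsum_eq, tsum_geometric_of_norm_lt_one hu1] at h3
  have h4 := h3.mul_left (u ^ 2)
  -- The term `p = 0` is an empty sum; dropping it leaves `u ^ 2` times a Cauchy product with the
  -- geometric series.
  rw [← hasSum_nat_add_iff' 1]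
  convert! h4 using 1
  · funext n
    rw [Complex.ofReal_sum, Finset.sum_mul, Finset.mul_sum]
    refine Finset.sum_congr rfl fun m hm => ?_
    have : m ≤ n := by simpa [Nat.lt_succ_iff] using hm
    rw [mul_assoc _ (u ^ m), ← pow_add, Nat.add_sub_cancel' this]
    ring
  · rw [show (-1 - 1 / u : ℂ) = -1 / u + -1 by ring, Complex.cpow_add _ _ h1u, Complex.cpow_neg_one]
    simp

/-! ### Flow between levels and asymptotics -/

/-- Conservation of mass: having left level `m` before time `M`, or being there at time `M`, amounts
to having entered it. -/
theorem sum_missProb_mul (m M : ℕ) :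
    ∑ n ∈ Finset.range M, missProb n m * (n / (n + 1)) + missProb M m =
      if m = 0 then 1 else ∑ n ∈ Finset.range M, missProb n (m - 1) * (n / (n + 1)) := by
  induction M with
  | zero => cases m <;> simp [missProb]
  | succ M ih =>
    cases m with
    | zero =>
      simp only [Finset.sum_range_succ, if_true, missProb] at ih ⊢
      refine Eq.trans ?_ ih
      field_simp
      ring
    | succ m =>
      simp only [Finset.sum_range_succ, missProb, Nat.succ_ne_zero, if_false,
        Nat.add_sub_cancel] at ih ⊢
      rw [← ih]
      field_simp
      ring

theorem summable_missProb_mul (m : ℕ) : Summable fun n : ℕ => missProb n m * (n / (n + 1)) := by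
  refine (summable_missProb m).of_nonneg_of_le
    (fun n => mul_nonneg (missProb_nonneg _ _) (by positivity)) fun n => ?_
  refine mul_le_of_le_one_right (missProb_nonneg _ _) ?_
  rw [div_le_one (by positivity)]
  linarith

theorem hasSum_missProb_mul (m : ℕ) : HasSum (fun n : ℕ => missProb n m * (n / (n + 1))) 1 := by
  have key (m : ℕ) := ((summable_missProb_mul m).hasSum.tendsto_sum_nat.add
    (summable_missProb m).tendsto_atTop_zero)
  simp only [sum_missProb_mul, add_zero] at key
  induction m with
  | zero =>
    have := tendsto_nhds_unique (key 0) (tendsto_const_nhds (x := (1 : ℝ)))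
    have h := (summable_missProb_mul 0).hasSum
    rwa [this] at h
  | succ m ih =>
    have := tendsto_nhds_unique (key (m + 1)) (by simpa using ih.tendsto_sum_nat)
    have h := (summable_missProb_mul (m + 1)).hasSum
    rwa [this] at h

theorem sum_missProb_eq_one {k N : ℕ} (h : k < N) : ∑ m ∈ Finset.range N, missProb k m = 1 := by
  have h1 := hasSum_missProb_mul_pow_real k 1
  have h2 : ∏ j ∈ Finset.range k, (1 + j * (1 : ℝ)) / (j + 1) = 1 :=
    Finset.prod_eq_one fun j _ => by field_simp; ring
  rw [h2] at h1
  simp only [one_pow, mul_one] at h1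
  refine (hasSum_sum_of_ne_finset_zero fun m hm => ?_).unique h1
  exact missProb_eq_zero_of_lt (by simp at hm; omega)

/-- With `S k` the probability of fewer than `N` misses in `k` throws, `e - N = ∑ S k / (k + 1)`.
The terms `k < N` give `H_N`, since there `S k = 1`. In the tail `1/(k+1) ≤ 1/(N+1)`, while `∑_{k ≥
N} S k = e - N`. -/
theorem sum_sojourn_bounds (N : ℕ) :
    N + (harmonic N : ℝ) ≤ ∑ m ∈ Finset.range N, sojourn m ∧
    (∑ m ∈ Finset.range N, sojourn m - N) * (N / (N + 1)) ≤ harmonic N := by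
  set S : ℕ → ℝ := fun k => ∑ m ∈ Finset.range N, missProb k m with hS
  set e := ∑ m ∈ Finset.range N, sojourn m with he
  have hS0 (k : ℕ) : 0 ≤ S k := Finset.sum_nonneg fun _ _ => missProb_nonneg _ _
  have h1 : HasSum S e := hasSum_sum fun m _ => (summable_missProb m).hasSum
  have h2 : HasSum (fun k : ℕ => S k * (k / (k + 1))) N := by
    have := hasSum_sum (s := Finset.range N) fun m _ => hasSum_missProb_mul m
    simpa [hS, Finset.sum_mul] using this
  have h3 : HasSum (fun k : ℕ => S k * (1 / (k + 1))) (e - N) := by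
    convert! h1.sub h2 using 1
    funext k
    field_simp
    ring
  have hS1 : ∀ k ∈ Finset.range N, S k = 1 := fun k hk =>
    sum_missProb_eq_one (Finset.mem_range.1 hk)
  have e1 := (hasSum_nat_add_iff' N).2 h1
  have e3 := (hasSum_nat_add_iff' N).2 h3
  rw [Finset.sum_congr rfl hS1] at e1
  rw [Finset.sum_congr rfl fun k hk => by rw [hS1 k hk, one_mul]] at e3
  have hH : ∑ k ∈ Finset.range N, 1 / ((k : ℝ) + 1) = harmonic N := by
    simp [harmonic]
  rw [hH] at e3
  simp only [Finset.sum_const, Finset.card_range, nsmul_eq_mul, mul_one] at e1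
  have l0 := e3.nonneg fun k => mul_nonneg (hS0 _) (by positivity)
  have l1 := hasSum_le (fun k => ?_) e3 (e1.mul_right (1 / ((N : ℝ) + 1)))
  · refine ⟨by linarith, ?_⟩
    have : (e - N) * (N / (N + 1)) = (e - N) - (e - N) * (1 / (N + 1)) := by
      field_simp
      ring
    linarith
  · refine mul_le_mul_of_nonneg_left ?_ (hS0 _)
    apply one_div_le_one_div_of_le (by positivity)
    push_cast
    linarith [Nat.cast_nonneg (α := ℝ) k]

theorem tendsto_sum_sojourn :
    Tendsto (fun p : ℕ => ∑ m ∈ Finset.range (p - 1), sojourn m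
        - ((p : ℝ) + Real.log p + Real.eulerMascheroniConstant - 1)) atTop (𝓝 0) := by
  have hlog : Tendsto (fun N : ℕ => (harmonic N : ℝ) - Real.log (N + 1)) atTop
      (𝓝 Real.eulerMascheroniConstant) := Real.tendsto_eulerMascheroniSeq
  have hdiv : Tendsto (fun N : ℕ => (harmonic N : ℝ) / N) atTop (𝓝 0) := by
    have h1 : Tendsto (fun N : ℕ => Real.log N / N) atTop (𝓝 0) := by
      have := (Real.isLittleO_log_id_atTop.tendsto_div_nhds_zero).comp
        (tendsto_natCast_atTop_atTop (R := ℝ))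
      exact this
    have h2 := (Real.tendsto_harmonic_sub_log).mul
      (tendsto_inv_atTop_nhds_zero_nat (𝕜 := ℝ))
    have := h2.add h1
    simp only [mul_zero, add_zero] at this
    refine this.congr fun N => ?_
    ring
  have hx : Tendsto (fun N : ℕ => ∑ m ∈ Finset.range N, sojourn m - N - harmonic N) atTop
      (𝓝 0) := by
    refine tendsto_of_tendsto_of_tendsto_of_le_of_le' tendsto_const_nhds hdiv ?_ ?_
    · exact Eventually.of_forall fun N => by linarith [(sum_sojourn_bounds N).1]
    · filter_upwards [eventually_gt_atTop 0] with N hN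
      have h := (sum_sojourn_bounds N).2
      have hN' : (0 : ℝ) < N := by exact_mod_cast hN
      rw [← mul_div_assoc, div_le_iff₀ (by positivity)] at h
      rw [le_div_iff₀ hN']
      linarith
  -- With `p = N + 1`, `log p` is the `log (N + 1)` of `hlog`, and `p - 1 = N`.
  rw [← tendsto_add_atTop_iff_nat 1]
  have := hx.add (hlog.sub_const Real.eulerMascheroniConstant)
  rw [sub_self, add_zero] at this
  refine this.congr fun N => ?_
  push_cast
  ring

/-! ### Game length in terms of misses -/

open Classical in
/-- The number of the first `n` throws that are not records. -/
noncomputable def missCount (x : ℕ → ℝ) (n : ℕ) : ℕ :=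
  ((Finset.range n).filter fun k => ¬ IsBest x k).card

theorem missCount_zero (x : ℕ → ℝ) : missCount x 0 = 0 := by simp [missCount]

theorem missCount_succ_of_isBest {x : ℕ → ℝ} {n : ℕ} (h : IsBest x n) :
    missCount x (n + 1) = missCount x n := by
  classical
  simp [missCount, Finset.range_add_one, Finset.filter_insert, h]

theorem missCount_succ_of_not_isBest {x : ℕ → ℝ} {n : ℕ} (h : ¬ IsBest x n) :
    missCount x (n + 1) = missCount x n + 1 := by
  classical
  simp [missCount, Finset.range_add_one, Finset.filter_insert, h]

theorem missCount_mono (x : ℕ → ℝ) : Monotone (missCount x) :=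
  monotone_nat_of_le_succ fun n => by
    by_cases h : IsBest x n
    · rw [missCount_succ_of_isBest h]
    · rw [missCount_succ_of_not_isBest h]; omega

theorem length_step {α : Type*} (s : Prop) [Decidable s] (l : List α) :
    (step s l).length = if 2 ≤ l.length ∧ ¬ s then l.length - 1 else l.length := by
  match l with
  | [] => simp [step]
  | [_] => simp [step]
  | _ :: _ :: _ => by_cases hs : s <;> simp [step, hs]

/-- The line freezes at one player while `missCount` keeps growing, hence the `max`. -/
theorem length_line {p : ℕ} (hp : 1 ≤ p) (x : ℕ → ℝ) (n : ℕ) :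
    (line p x n).length = max (p - missCount x n) 1 := by
  classical
  induction n with
  | zero => simp [line, missCount_zero, hp]
  | succ n ih =>
    rw [line, length_step, ih]
    by_cases h : IsBest x n
    · simp [missCount_succ_of_isBest h, h]
    · rw [missCount_succ_of_not_isBest h]
      simp only [h, not_false_eq_true, and_true]
      split_ifs <;> omega

theorem lt_gameLength_iff {p : ℕ} (hp : 1 ≤ p) (x : ℕ → ℝ) (k : ℕ) :
    (k : ℕ∞) < gameLength p x ↔ missCount x k + 2 ≤ p := by
  constructor
  · intro h
    by_contra hk
    refine absurd h (not_lt.2 (iInf₂_le k ?_))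
    rw [length_line hp]
    omega
  · intro h
    refine lt_of_lt_of_le (b := ((k + 1 : ℕ) : ℕ∞)) (by exact_mod_cast Nat.lt_succ_self k)
      (le_iInf₂ fun n hn => ?_)
    rw [length_line hp] at hn
    by_contra hlt
    have hlt : n ≤ k := by
      rw [not_le, Nat.cast_lt] at hlt
      omega
    have := missCount_mono x hlt
    omega

open Classical in
theorem toENNReal_gameLength {p : ℕ} (hp : 1 ≤ p) (x : ℕ → ℝ) :
    (gameLength p x : ℝ≥0∞) = ∑' k : ℕ, if missCount x k + 2 ≤ p then 1 else 0 := by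
  simp_rw [← lt_gameLength_iff hp]
  generalize gameLength p x = L
  induction L with
  | top => simp
  | coe n =>
    rw [tsum_eq_sum (s := Finset.range n) fun k hk => by simpa using hk]
    rw [Finset.sum_congr rfl fun k hk => if_pos (by simpa using hk)]
    simp

/-! ### Order events and measurability -/

/-- The order event: `x` is strictly increasing along `e`. -/
def chain {n : ℕ} (e : Fin n → ℕ) : Set (ℕ → ℝ) := {x | StrictMono (x ∘ e)}

theorem measurableSet_strictMono (n : ℕ) : MeasurableSet {y : Fin n → ℝ | StrictMono y} := by
  simp only [StrictMono, Set.ofPred_forall]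
  refine MeasurableSet.iInter fun i => MeasurableSet.iInter fun j => MeasurableSet.iInter fun _ => ?_
  exact measurableSet_lt (measurable_pi_apply i) (measurable_pi_apply j)

theorem measurableSet_chain {n : ℕ} (e : Fin n → ℕ) : MeasurableSet (chain e) :=
  (measurable_pi_lambda (fun x : ℕ → ℝ => x ∘ e) fun i => measurable_pi_apply (e i))
    (measurableSet_strictMono n)

theorem measurableSet_isBest (n : ℕ) : MeasurableSet {x : ℕ → ℝ | IsBest x n} := by
  simp only [IsBest, Set.ofPred_forall]
  refine MeasurableSet.iInter fun i => MeasurableSet.iInter fun _ => ?_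
  exact measurableSet_lt (measurable_pi_apply n) (measurable_pi_apply i)

theorem measurableSet_missCount (n m : ℕ) : MeasurableSet {x : ℕ → ℝ | missCount x n = m} := by
  induction n generalizing m with
  | zero => simp [missCount_zero]
  | succ n ih =>
    have h : {x : ℕ → ℝ | missCount x (n + 1) = m} =
        ({x | missCount x n = m} ∩ {x | IsBest x n}) ∪
        ({x | missCount x n + 1 = m} ∩ {x | IsBest x n}ᶜ) := by
      ext x
      by_cases h : IsBest x n
      · simp [h, missCount_succ_of_isBest h]
      · simp [h, missCount_succ_of_not_isBest h]
    rw [h]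
    refine ((ih m).inter (measurableSet_isBest n)).union (.inter ?_ (measurableSet_isBest n).compl)
    cases m with
    | zero => simp
    | succ m => simpa using ih m

theorem measurable_missCount (n : ℕ) : Measurable fun x : ℕ → ℝ => missCount x n :=
  measurable_to_countable' fun m => measurableSet_missCount n m

theorem measurableSet_missCount_add_two_le (n p : ℕ) :
    MeasurableSet {x : ℕ → ℝ | missCount x n + 2 ≤ p} :=
  measurable_missCount n (MeasurableSet.of_discrete (s := {j : ℕ | j + 2 ≤ p}))

/-- The sequence of positions visited by a permutation of the first `n` throws. -/
def positions {n : ℕ} (σ : Equiv.Perm (Fin n)) (i : Fin n) : ℕ := σ i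

theorem positions_injective {n : ℕ} (σ : Equiv.Perm (Fin n)) : (positions σ).Injective :=
  Fin.val_injective.comp σ.injective

theorem lt_iff_of_mem_chain {n : ℕ} {σ : Equiv.Perm (Fin n)} {x : ℕ → ℝ}
    (hx : x ∈ chain (positions σ)) (i j : Fin n) : x i < x j ↔ σ.symm i < σ.symm j := by
  have := StrictMono.lt_iff_lt hx (a := σ.symm i) (b := σ.symm j)
  simpa [positions] using this

theorem missCount_eq_of_mem_chain {n : ℕ} {σ : Equiv.Perm (Fin n)} {x y : ℕ → ℝ}
    (hx : x ∈ chain (positions σ)) (hy : y ∈ chain (positions σ)) :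
    missCount x n = missCount y n := by
  classical
  unfold missCount
  congr 1
  refine Finset.filter_congr fun k hk => not_congr ?_
  rw [Finset.mem_range] at hk
  refine forall₂_congr fun m hm => ?_
  rw [lt_iff_of_mem_chain hx ⟨k, hk⟩ ⟨m, hm.trans hk⟩, lt_iff_of_mem_chain hy ⟨k, hk⟩ ⟨m, hm.trans hk⟩]

/-- A record at throw `n` puts the new index in front of the sorted earlier ones, so the
intersection is again a single order event. -/
theorem chain_inter_isBest {n : ℕ} (σ : Equiv.Perm (Fin n)) :
    chain (positions σ) ∩ {x | IsBest x n} =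
      chain (Fin.cons n (positions σ) : Fin (n + 1) → ℕ) := by
  ext x
  have h : x ∘ (Fin.cons n (positions σ) : Fin (n + 1) → ℕ) = Fin.cons (x n) (x ∘ positions σ) := by
    funext i
    refine Fin.cases ?_ (fun i => ?_) i <;> simp
  simp only [chain, Set.mem_inter_iff, Set.mem_ofPred_eq, h, Fin.strictMono_cons, IsBest]
  rw [and_comm]
  refine and_congr_left fun _ => ⟨fun H i => H _ (σ i).2, fun H m hm => ?_⟩
  simpa [positions] using H (σ.symm ⟨m, hm⟩)

theorem cons_positions_injective {n : ℕ} (σ : Equiv.Perm (Fin n)) :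
    (Fin.cons n (positions σ) : Fin (n + 1) → ℕ).Injective := by
  rw [Fin.cons_injective_iff]
  refine ⟨?_, positions_injective σ⟩
  rintro ⟨i, hi⟩
  exact absurd hi (σ i).2.ne

theorem exists_mem_chain {x : ℕ → ℝ} (hx : x.Injective) (n : ℕ) :
    ∃ σ : Equiv.Perm (Fin n), x ∈ chain (positions σ) := by
  refine ⟨Tuple.sort fun i : Fin n => x i, ?_⟩
  exact (Tuple.monotone_sort fun i : Fin n => x i).strictMono_of_injective
    (hx.comp (positions_injective _))

theorem eq_of_mem_chain {n : ℕ} {σ τ : Equiv.Perm (Fin n)} {x : ℕ → ℝ}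
    (hσ : x ∈ chain (positions σ)) (hτ : x ∈ chain (positions τ)) : σ = τ := by
  have hx : (fun i : Fin n => x i).Injective := by
    have := hσ.injective.comp σ.symm.injective
    convert this using 1
    funext i
    simp [positions]
  have := Tuple.unique_monotone (f := fun i : Fin n => x i) (σ := σ) (τ := τ)
    hσ.monotone hτ.monotone
  ext i
  exact congrArg Fin.val (hx (congrFun this i))

/-! ### Exchangeable sequences: the law of the miss count -/

section Exchangeable

variable {Q : Measure (ℕ → ℝ)}

theorem measure_eq_sum_chain (hinj : ∀ᵐ x ∂Q, x.Injective) (n : ℕ) {A : Set (ℕ → ℝ)}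
    (hA : MeasurableSet A) :
    Q A = ∑ σ : Equiv.Perm (Fin n), Q (A ∩ chain (positions σ)) := by
  have h : Q A = Q (⋃ σ : Equiv.Perm (Fin n), A ∩ chain (positions σ)) := by
    refine measure_congr ?_
    filter_upwards [hinj] with x hx
    obtain ⟨σ, hσ⟩ := exists_mem_chain hx n
    refine propext ⟨fun h => Set.mem_iUnion.2 ⟨σ, h, hσ⟩, fun h => ?_⟩
    obtain ⟨τ, hτ⟩ := Set.mem_iUnion.1 h
    exact hτ.1
  rw [h, measure_iUnion, tsum_fintype]
  · intro σ τ hne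
    rw [Function.onFun, Set.disjoint_left]
    exact fun x h1 h2 => hne (eq_of_mem_chain h1.2 h2.2)
  · exact fun σ => hA.inter (measurableSet_chain _)

/-- The `n!` orderings of the first `n` throws are equally likely and almost surely partition the
space. -/
theorem factorial_mul_measure_chain [IsProbabilityMeasure Q] (hinj : ∀ᵐ x ∂Q, x.Injective)
    (hex : ∀ n (e e' : Fin n → ℕ), e.Injective → e'.Injective → Q (chain e) = Q (chain e'))
    {n : ℕ} {e : Fin n → ℕ} (he : e.Injective) : (n.factorial : ℝ≥0∞) * Q (chain e) = 1 := by
  have h := measure_eq_sum_chain hinj n MeasurableSet.univ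
  simp only [measure_univ, Set.univ_inter] at h
  rw [Finset.sum_congr rfl fun σ _ => hex n _ e (positions_injective σ) he] at h
  simpa [Fintype.card_perm] using h.symm

/-- Independence of a record from the past: on each ordering of the first `n` throws the record
event has relative weight `n!/(n+1)!`. -/
theorem measure_missCount_inter_isBest [IsProbabilityMeasure Q] (hinj : ∀ᵐ x ∂Q, x.Injective)
    (hex : ∀ n (e e' : Fin n → ℕ), e.Injective → e'.Injective → Q (chain e) = Q (chain e'))
    (n m : ℕ) :
    ((n : ℝ≥0∞) + 1) * Q ({x | missCount x n = m} ∩ {x | IsBest x n}) =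
      Q {x | missCount x n = m} := by
  rw [measure_eq_sum_chain hinj n ((measurableSet_missCount n m).inter (measurableSet_isBest n)),
    measure_eq_sum_chain hinj n (measurableSet_missCount n m), Finset.mul_sum]
  refine Finset.sum_congr rfl fun σ _ => ?_
  -- The miss count is constant on a chain, so the chain lies inside the event or misses it.
  by_cases h : ∃ x ∈ chain (positions σ), missCount x n = m
  · obtain ⟨x, hx, hxm⟩ := h
    have hsub : chain (positions σ) ⊆ {x | missCount x n = m} := fun y hy =>
      (missCount_eq_of_mem_chain hy hx).trans hxm
    rw [Set.inter_right_comm, Set.inter_eq_right.2 hsub, chain_inter_isBest]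
    have h1 := factorial_mul_measure_chain hinj hex (positions_injective σ)
    have h2 := factorial_mul_measure_chain hinj hex (cons_positions_injective σ)
    rw [Nat.factorial_succ, Nat.cast_mul, mul_comm (((n + 1 : ℕ)) : ℝ≥0∞), mul_assoc, ← h1,
      ENNReal.mul_right_inj (by exact_mod_cast n.factorial_ne_zero) (ENNReal.natCast_ne_top _)] at h2
    exact_mod_cast h2
  · push Not at h
    have : ({x | missCount x n = m} ∩ chain (positions σ)) = ∅ := by
      ext x
      simp only [Set.mem_inter_iff, Set.mem_ofPred_eq, Set.mem_empty_iff_false, iff_false]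
      exact fun hx => h x hx.2 hx.1
    rw [Set.inter_right_comm, this]
    simp

theorem measureReal_missCount [IsProbabilityMeasure Q] (hinj : ∀ᵐ x ∂Q, x.Injective)
    (hex : ∀ n (e e' : Fin n → ℕ), e.Injective → e'.Injective → Q (chain e) = Q (chain e'))
    (n m : ℕ) : Q.real {x | missCount x n = m} = missProb n m := by
  have hbest (n m : ℕ) : Q.real ({x | missCount x n = m} ∩ {x | IsBest x n}) =
      Q.real {x | missCount x n = m} / (n + 1) := by
    have h := congrArg ENNReal.toReal (measure_missCount_inter_isBest hinj hex n m)
    rw [ENNReal.toReal_mul, ENNReal.toReal_add (by simp) (by simp)] at h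
    rw [eq_div_iff (by positivity), mul_comm]
    simpa [Measure.real] using h
  have hnot (n m : ℕ) : Q.real ({x | missCount x n = m} ∩ {x | IsBest x n}ᶜ) =
      n / (n + 1) * Q.real {x | missCount x n = m} := by
    have h := measureReal_inter_add_sdiff (μ := Q) (s := {x | missCount x n = m}) (measurableSet_isBest n)
    rw [hbest, Set.sdiff_eq] at h
    rw [eq_sub_iff_add_eq'.2 h]
    field_simp
    ring
  induction n generalizing m with
  | zero => cases m <;> simp [missCount_zero, missProb]
  | succ n ih =>
    cases m with
    | zero =>
      have h : {x : ℕ → ℝ | missCount x (n + 1) = 0} =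
          {x | missCount x n = 0} ∩ {x | IsBest x n} := by
        ext x
        by_cases h : IsBest x n
        · simp [h, missCount_succ_of_isBest h]
        · simp [h, missCount_succ_of_not_isBest h]
      rw [h, hbest, ih, missProb]
    | succ m =>
      have h : {x : ℕ → ℝ | missCount x (n + 1) = m + 1} =
          ({x | missCount x n = m + 1} ∩ {x | IsBest x n}) ∪
          ({x | missCount x n = m} ∩ {x | IsBest x n}ᶜ) := by
        ext x
        by_cases h : IsBest x n
        · simp [h, missCount_succ_of_isBest h]
        · simp [h, missCount_succ_of_not_isBest h]
      rw [h, measureReal_union (Set.disjoint_left.2 fun x h1 h2 => h2.2 h1.2)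
        ((measurableSet_missCount n m).inter (measurableSet_isBest n).compl), hbest, hnot, ih, ih,
        missProb]

theorem lintegral_gameLength [IsProbabilityMeasure Q] (hinj : ∀ᵐ x ∂Q, x.Injective)
    (hex : ∀ n (e e' : Fin n → ℕ), e.Injective → e'.Injective → Q (chain e) = Q (chain e'))
    {p : ℕ} (hp : 1 ≤ p) :
    ∫⁻ x, (gameLength p x : ℝ≥0∞) ∂Q =
      ENNReal.ofReal (∑ m ∈ Finset.range (p - 1), sojourn m) := by
  classical
  have hmeas (k : ℕ) := measurableSet_missCount_add_two_le k p
  have hQ (k : ℕ) : Q {x : ℕ → ℝ | missCount x k + 2 ≤ p} =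
      ∑ m ∈ Finset.range (p - 1), ENNReal.ofReal (missProb k m) := by
    have h : {x : ℕ → ℝ | missCount x k + 2 ≤ p} =
        ⋃ m ∈ Finset.range (p - 1), {x | missCount x k = m} := by
      ext x
      simp
      omega
    rw [h, measure_biUnion_finset ?_ fun m _ => measurableSet_missCount k m]
    · refine Finset.sum_congr rfl fun m _ => ?_
      rw [← measureReal_missCount hinj hex, ofReal_measureReal]
    · intro i _ j _ hij
      rw [Function.onFun, Set.disjoint_left]
      exact fun x h1 h2 => hij (h1.symm.trans h2)
  simp_rw [toENNReal_gameLength hp]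
  rw [lintegral_tsum fun k => (Measurable.ite (hmeas k) measurable_const measurable_const).aemeasurable]
  have hk (k : ℕ) : ∫⁻ x, (if missCount x k + 2 ≤ p then 1 else 0 : ℝ≥0∞) ∂Q =
      ∑ m ∈ Finset.range (p - 1), ENNReal.ofReal (missProb k m) := by
    rw [← hQ, ← lintegral_indicator_one (hmeas k)]
    refine lintegral_congr fun x => ?_
    by_cases hx : missCount x k + 2 ≤ p <;> simp [hx]
  simp_rw [hk]
  rw [Summable.tsum_finsetSum fun _ _ => ENNReal.summable,
    ENNReal.ofReal_sum_of_nonneg fun m _ => sojourn_nonneg m]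
  refine Finset.sum_congr rfl fun m _ => ?_
  rw [sojourn, ENNReal.ofReal_tsum_of_nonneg (fun _ => missProb_nonneg _ _) (summable_missProb m)]

end Exchangeable

/-! ### From i.i.d. throws to exchangeability -/

theorem expectedLength_eq {Ω : Type*} [MeasurableSpace Ω] (P : Measure Ω) [IsProbabilityMeasure P]
    (X : ℕ → Ω → ℝ) (hmeas : ∀ i, Measurable (X i)) (hindep : iIndepFun X P)
    (hident : ∀ i, IdentDistrib (X i) (X 0) P P)
    (hties : ∀ i j, i ≠ j → P {ω | X i ω = X j ω} = 0) {p : ℕ} (hp : 1 ≤ p) :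
    expectedLength P X p = ENNReal.ofReal (∑ m ∈ Finset.range (p - 1), sojourn m) := by
  have hX : Measurable fun ω i => X i ω := measurable_pi_lambda _ hmeas
  have hinjω : ∀ᵐ ω ∂P, (fun i => X i ω).Injective := by
    have h : ∀ᵐ ω ∂P, ∀ i j, i ≠ j → X i ω ≠ X j ω := by
      simp only [ae_all_iff]
      intro i j hij
      simpa [ae_iff] using hties i j hij
    filter_upwards [h] with ω hω i j hij
    by_contra hne
    exact hω i j hne hij
  have hinj : ∀ᵐ x ∂P.map (fun ω i => X i ω), x.Injective := by
    have hm : MeasurableSet {x : ℕ → ℝ | x.Injective} := by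
      simp only [Function.Injective, Set.ofPred_forall]
      refine MeasurableSet.iInter fun i => MeasurableSet.iInter fun j => ?_
      by_cases hij : i = j
      · simp [hij]
      · simpa [hij, Set.compl_def] using
          (measurableSet_eq_fun (measurable_pi_apply i) (measurable_pi_apply j)).compl
    exact (ae_map_iff hX.aemeasurable hm).2 hinjω
  -- Any `n` distinct throws have the same product law, which gives the exchangeability of order
  -- events.
  have hlaw {n : ℕ} {e : Fin n → ℕ} (he : e.Injective) : P.map (fun ω i => X i ω) (chain e) =
      Measure.pi (fun _ : Fin n => P.map (X 0)) {y | StrictMono y} := by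
    have h := (iIndepFun_iff_map_fun_eq_pi_map fun i => (hmeas (e i)).aemeasurable).1
      (hindep.precomp he)
    simp only [(hident _).map_eq] at h
    rw [← h, Measure.map_apply hX (measurableSet_chain e),
      Measure.map_apply (measurable_pi_lambda _ fun i => hmeas (e i)) (measurableSet_strictMono n)]
    rfl
  have := Measure.isProbabilityMeasure_map (μ := P) hX.aemeasurable
  rw [← lintegral_gameLength hinj (fun n e e' he he' => (hlaw he).trans (hlaw he').symm) hp,
    lintegral_map _ hX, expectedLength]
  classical
  simp_rw [toENNReal_gameLength hp]
  refine Measurable.tsum fun k => Measurable.ite ?_ measurable_const measurable_const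
  exact measurableSet_missCount_add_two_le k p

end DartGame

theorem mainTheorem2 {Ω : Type*} [MeasurableSpace Ω] (P : Measure Ω) [IsProbabilityMeasure P]
    (X : ℕ → Ω → ℝ) (hmeas : ∀ i, Measurable (X i)) (hindep : iIndepFun X P)
    (hident : ∀ i, IdentDistrib (X i) (X 0) P P)
    (hties : ∀ i j, i ≠ j → P {ω | X i ω = X j ω} = 0) :
    (∀ p : ℕ, 1 ≤ p → DartGame.expectedLength P X p ≠ ∞) ∧
    (∀ u : ℂ, ‖u‖ < 1 →
      HasSum (fun p : ℕ => ((DartGame.expectedLength P X (p + 1)).toReal : ℂ) * u ^ (p + 1))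
        (u ^ 2 * (1 - u) ^ (-1 - 1 / u))) ∧
    Tendsto
      (fun p : ℕ => (DartGame.expectedLength P X p).toReal
        - ((p : ℝ) + Real.log p + Real.eulerMascheroniConstant - 1))
      atTop (𝓝 0) := by
  have h {p : ℕ} (hp : 1 ≤ p) := DartGame.expectedLength_eq P X hmeas hindep hident hties hp
  have hr {p : ℕ} (hp : 1 ≤ p) : (DartGame.expectedLength P X p).toReal =
      ∑ m ∈ Finset.range (p - 1), DartGame.sojourn m := by
    rw [h hp, ENNReal.toReal_ofReal (Finset.sum_nonneg fun m _ => DartGame.sojourn_nonneg m)]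
  refine ⟨fun p hp => by simp [h hp], fun u hu => ?_, ?_⟩
  · simp_rw [hr (Nat.le_add_left 1 _), Nat.add_sub_cancel]
    exact DartGame.hasSum_sum_sojourn_mul_pow hu
  · refine DartGame.tendsto_sum_sojourn.congr' ?_
    filter_upwards [eventually_ge_atTop 1] with p hp
    rw [hr hp]
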